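/- A planar convex body is a compact convex set $K\subset\mathbb R^2$ with non-empty interior. Write $r(K)=\max_{x\in K}\operatorname{dist}(x,\partial K)$ for its inradius and, for $t\ge 0$, $K_{-t}=\{x\in K:\operatorname{dist}(x,\partial K)\ge t\}$ for its inner parallel set at distance $t$. For a non-empty compact convex set $L\subset\mathbb R^2$ let $h_L(\nu)=\max_{x\in L}x\cdot\nu$ be its support function and $w(L)=\min_{|\nu|=1}\bigl(h_L(\nu)+h_L(-\nu)\bigr)$ its minimal width. Let $K$ be a planar convex body. Then for all $t\in[0,r(K)]$, $$w(K_{-t})\ \ge\ w(K)-3t .$$ Moreover, equality is attained for equilateral triangles: if $T$ is a (non-degenerate, closed, filled) equilateral triangle in $\mathbb R^2$, then $w(T_{-t})=w(T)-3t$ for all $t\in[0,r(T)]$. -/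

import Mathlib

open Set

noncomputable section

/-- A convex body in `ℝ^d`: a compact convex set with non-empty interior. -/
structure IsConvexBody {d : ℕ} (K : Set (EuclideanSpace ℝ (Fin d))) : Prop where
  isCompact : IsCompact K
  convex : Convex ℝ K
  interior_nonempty : (interior K).Nonempty

/-- The inradius `r(K) = max_{x ∈ K} dist(x, ∂K)` (the supremum is attained on convex bodies). -/
def inradius {d : ℕ} (K : Set (EuclideanSpace ℝ (Fin d))) : ℝ :=
  sSup ((fun x => Metric.infDist x (frontier K)) '' K)

/-- The inner parallel set `K_{-t} = {x ∈ K : dist(x, ∂K) ≥ t}`. -/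
def innerParallel {d : ℕ} (K : Set (EuclideanSpace ℝ (Fin d))) (t : ℝ) :
    Set (EuclideanSpace ℝ (Fin d)) :=
  {x | x ∈ K ∧ t ≤ Metric.infDist x (frontier K)}

/-- The support function `h_K(ν) = max_{x ∈ K} x · ν`
(the supremum is attained on non-empty compact sets). -/
def supportFun {d : ℕ} (K : Set (EuclideanSpace ℝ (Fin d))) (ν : EuclideanSpace ℝ (Fin d)) : ℝ :=
  sSup ((fun x => inner ℝ x ν) '' K)

/-- The directional width `w_ν(K) = h_K(ν) + h_K(-ν)`. -/
def dirWidth {d : ℕ} (K : Set (EuclideanSpace ℝ (Fin d))) (ν : EuclideanSpace ℝ (Fin d)) : ℝ :=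
  supportFun K ν + supportFun K (-ν)

/-- The minimal width `w(K) = min_{|ν| = 1} w_ν(K)`
(the infimum is attained on non-empty compact sets, for `d ≥ 1`). -/
def minWidth {d : ℕ} (K : Set (EuclideanSpace ℝ (Fin d))) : ℝ :=
  sInf (dirWidth K '' Metric.sphere 0 1)

end

open Module Metric

/-! Helly's theorem gives a point `x` such that for every `y ∈ K` the point `x + (x - y) / d` is
again in `K`. So in each direction the support line of `K` is at least `w / (d + 1)` away from `x`,
and `K` contains a ball of that radius. Contracting `K` towards `x` by `1 - s`, with `s = (d + 1) t
/ w`, lands in the inner parallel set and has minimal width `w - (d + 1) t`. For an equilateral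
triangle the outward unit normals sum to zero. Moving each side in by `t` therefore costs `3 t` of
the width normal to a side, which is the minimal width. -/

open scoped Pointwise in
-- Any `d + 1` of the sets `(y + d K) / (d + 1)` share the centroid of their points `y`: the average
-- of the other `d` points serves as `z`.
theorem exists_forall_mem_exists_mem_smul_eq_add {E : Type*} [NormedAddCommGroup E]
    [NormedSpace ℝ E] [FiniteDimensional ℝ E] {K : Set E} (hc : IsCompact K) (hv : Convex ℝ K)
    (hn : K.Nonempty) :
    ∃ x, ∀ y ∈ K, ∃ z ∈ K, ((finrank ℝ E : ℝ) + 1) • x = y + (finrank ℝ E : ℝ) • z := by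
  classical
  set d := finrank ℝ E with hd
  have hd1 : ((d : ℝ) + 1) ≠ 0 := by positivity
  have : Nonempty K := hn.to_subtype
  -- The factor `ℕ` makes the index type infinite, so Helly's cardinality condition holds even when
  -- `K` has few points.
  let F : ℕ × K → Set E := fun i =>
    (fun z => ((d : ℝ) + 1)⁻¹ • ((i.2 : E) + (d : ℝ) • z)) '' K
  have key : (⋂ i, F i).Nonempty := by
    apply Convex.helly_theorem_compact (𝕜 := ℝ)
    · simp
    · intro i
      have h := ((hv.smul (d : ℝ)).translate (i.2 : E)).smul ((d : ℝ) + 1)⁻¹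
      have hF : F i = ((d : ℝ) + 1)⁻¹ • (fun x => (i.2 : E) + x) '' ((d : ℝ) • K) := by
        simp only [F, ← Set.image_smul, Set.image_image]
      rwa [hF]
    · intro i
      exact hc.image (by fun_prop)
    · intro I hI
      refine ⟨((d : ℝ) + 1)⁻¹ • ∑ j ∈ I, (j.2 : E), ?_⟩
      simp only [Set.mem_iInter]
      intro i hi
      have hcard : (I.erase i).card = d := by rw [Finset.card_erase_of_mem hi, hI]; simp [hd]
      obtain ⟨z, hz, hzs⟩ : ∃ z ∈ K, (d : ℝ) • z = ∑ j ∈ I.erase i, (j.2 : E) := by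
        rcases Nat.eq_zero_or_pos d with h0 | h0
        · obtain ⟨z, hz⟩ := hn
          refine ⟨z, hz, ?_⟩
          rw [h0, Finset.card_eq_zero] at hcard
          simp [h0, hcard]
        · have h0' : (d : ℝ) ≠ 0 := by positivity
          refine ⟨∑ j ∈ I.erase i, (d : ℝ)⁻¹ • (j.2 : E), ?_, ?_⟩
          · refine hv.sum_mem (fun _ _ => by positivity) ?_ (fun j _ => j.2.2)
            rw [Finset.sum_const, hcard, nsmul_eq_mul, mul_inv_cancel₀ h0']
          · rw [← Finset.smul_sum, smul_inv_smul₀ h0']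
      refine ⟨z, hz, ?_⟩
      simp only
      rw [hzs, Finset.add_sum_erase I (fun j => (j.2 : E)) hi]
  obtain ⟨x, hx⟩ := key
  refine ⟨x, fun y hy => ?_⟩
  obtain ⟨z, hz, rfl⟩ := Set.mem_iInter.1 hx (0, ⟨y, hy⟩)
  exact ⟨z, hz, smul_inv_smul₀ hd1 _⟩

/-! ### Support functions, widths and inner parallel sets -/

section Support

variable {d : ℕ} {K : Set (EuclideanSpace ℝ (Fin d))} {x ν : EuclideanSpace ℝ (Fin d)} {t : ℝ}

theorem inner_le_supportFun (hK : IsCompact K) (hx : x ∈ K) : inner ℝ x ν ≤ supportFun K ν :=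
  le_csSup (hK.image (f := fun x => inner ℝ x ν) (by fun_prop)).bddAbove (Set.mem_image_of_mem _ hx)

theorem supportFun_le (hn : K.Nonempty) {c : ℝ} (h : ∀ x ∈ K, inner ℝ x ν ≤ c) :
    supportFun K ν ≤ c :=
  csSup_le (hn.image _) (by rintro _ ⟨x, hx, rfl⟩; exact h x hx)

theorem exists_supportFun_eq_inner (hK : IsCompact K) (hn : K.Nonempty)
    (ν : EuclideanSpace ℝ (Fin d)) : ∃ x ∈ K, supportFun K ν = inner ℝ x ν :=
  hK.exists_sSup_image_eq hn (f := fun x => inner ℝ x ν) (by fun_prop)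

theorem inner_sub_le_dirWidth (hK : IsCompact K) {y : EuclideanSpace ℝ (Fin d)} (hx : x ∈ K)
    (hy : y ∈ K) : inner ℝ (x - y) ν ≤ dirWidth K ν := by
  have h1 := inner_le_supportFun (ν := ν) hK hx
  have h2 := inner_le_supportFun (ν := -ν) hK hy
  rw [inner_neg_right] at h2
  rw [inner_sub_left, dirWidth]
  linarith

theorem dirWidth_nonneg (hK : IsCompact K) : 0 ≤ dirWidth K ν := by
  rcases K.eq_empty_or_nonempty with rfl | ⟨x, hx⟩
  · simp [dirWidth, supportFun]
  · simpa using inner_sub_le_dirWidth (ν := ν) hK hx hx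

theorem minWidth_nonneg (hK : IsCompact K) : 0 ≤ minWidth K :=
  Real.sInf_nonneg (by rintro _ ⟨ν, -, rfl⟩; exact dirWidth_nonneg hK)

theorem minWidth_le_dirWidth (hK : IsCompact K) (hν : ‖ν‖ = 1) : minWidth K ≤ dirWidth K ν :=
  csInf_le ⟨0, by rintro _ ⟨ν, -, rfl⟩; exact dirWidth_nonneg hK⟩
    (Set.mem_image_of_mem _ (by simpa using hν))

theorem le_minWidth [NeZero d] {c : ℝ} (h : ∀ ν, ‖ν‖ = 1 → c ≤ dirWidth K ν) :
    c ≤ minWidth K := by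
  refine le_csInf ((NormedSpace.sphere_nonempty.2 zero_le_one).image _) ?_
  rintro _ ⟨ν, hν, rfl⟩
  exact h ν (by simpa using hν)

theorem isCompact_innerParallel (hK : IsCompact K) (t : ℝ) : IsCompact (innerParallel K t) :=
  hK.inter_right (isClosed_le continuous_const (continuous_infDist_pt _))

theorem frontier_nonempty_of_isCompact [NeZero d] (hK : IsCompact K) (hn : K.Nonempty) :
    (frontier K).Nonempty :=
  nonempty_frontier_iff.2 ⟨hn, hK.ne_univ⟩

theorem ball_subset_of_mem_innerParallel [NeZero d] (hK : IsCompact K)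
    (hx : x ∈ innerParallel K t) : ball x t ⊆ K := by
  intro y hy
  by_contra hyK
  obtain ⟨z, hz, hxz⟩ := exists_mem_frontier_infDist_compl_eq_dist hx.1 hK.ne_univ
  have h1 := infDist_le_dist_of_mem (x := x) hz
  have h2 := infDist_le_dist_of_mem (x := x) (Set.mem_compl hyK)
  have h3 := hx.2
  rw [mem_ball, dist_comm] at hy
  linarith

theorem mem_innerParallel_of_ball_subset [NeZero d] (hK : IsCompact K) (hx : x ∈ K)
    (h : ball x t ⊆ K) : x ∈ innerParallel K t := by
  refine ⟨hx, (le_infDist (frontier_nonempty_of_isCompact hK ⟨x, hx⟩)).2 fun y hy => ?_⟩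
  by_contra! hlt
  exact hy.2 (interior_maximal h isOpen_ball (by rwa [mem_ball, dist_comm]))

theorem inner_le_sub_of_mem_innerParallel [NeZero d] (hK : IsCompact K) (hν : ‖ν‖ = 1) {h : ℝ}
    (hh : ∀ y ∈ K, inner ℝ y ν ≤ h) (hx : x ∈ innerParallel K t) : inner ℝ x ν ≤ h - t := by
  by_contra! hlt
  obtain ⟨s, hs1, hs2⟩ := exists_between (show h - inner ℝ x ν < t by linarith)
  have hs0 : 0 ≤ s := by linarith [hh x hx.1]
  have hmem : x + s • ν ∈ K :=
    ball_subset_of_mem_innerParallel hK hx (by simp [norm_smul, hν, abs_of_nonneg hs0, hs2])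
  have := hh _ hmem
  rw [inner_add_left, real_inner_smul_left, real_inner_self_eq_norm_sq, hν] at this
  linarith

theorem mem_of_forall_inner_le_supportFun (hK : IsCompact K) (hv : Convex ℝ K) (hn : K.Nonempty)
    (h : ∀ ν, ‖ν‖ = 1 → inner ℝ x ν ≤ supportFun K ν) : x ∈ K := by
  by_contra hx
  obtain ⟨f, u, hf, hu⟩ := geometric_hahn_banach_closed_point hv hK.isClosed hx
  set v := (InnerProductSpace.toDual ℝ _).symm f with hvdef
  have hfv : ∀ y, f y = inner ℝ y v := fun y => by
    rw [real_inner_comm, hvdef, InnerProductSpace.toDual_symm_apply]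
  have hv0 : 0 < ‖v‖ := by
    rw [norm_pos_iff]
    intro h0
    obtain ⟨y, hy⟩ := hn
    have h1 := hf y hy
    rw [hfv, h0, inner_zero_right] at h1 hu
    linarith
  obtain ⟨y, hy, hyv⟩ := exists_supportFun_eq_inner hK hn (‖v‖⁻¹ • v)
  have h1 := h (‖v‖⁻¹ • v) (by rw [norm_smul, norm_inv, norm_norm, inv_mul_cancel₀ hv0.ne'])
  rw [hyv, real_inner_smul_right, real_inner_smul_right,
    mul_le_mul_iff_right₀ (inv_pos.2 hv0), ← hfv, ← hfv] at h1
  linarith [hf y hy]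

/-- A convex body of minimal width `w` in `ℝ^d` contains a ball of radius `w / (d + 1)`. -/
theorem exists_ball_subset_of_minWidth (hK : IsCompact K) (hv : Convex ℝ K) (hn : K.Nonempty) :
    ∃ x ∈ K, ball x (minWidth K / (d + 1)) ⊆ K := by
  obtain ⟨x, hx⟩ := exists_forall_mem_exists_mem_smul_eq_add hK hv hn
  rw [finrank_euclideanSpace_fin] at hx
  have hd1 : (0 : ℝ) < d + 1 := by positivity
  have hball : ∀ ν, ‖ν‖ = 1 → inner ℝ x ν + minWidth K / (d + 1) ≤ supportFun K ν := by
    intro ν hν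
    -- Take `y` lowest in direction `ν`; its partner `z` is then high enough above `x`.
    obtain ⟨y, hy, hyν⟩ := exists_supportFun_eq_inner hK hn (-ν)
    obtain ⟨z, hz, hxyz⟩ := hx y hy
    have h1 := inner_le_supportFun (ν := ν) hK hz
    have h2 := minWidth_le_dirWidth hK hν
    have h3 := congrArg (fun a => inner ℝ a ν) hxyz
    simp only [inner_add_left, real_inner_smul_left] at h3
    rw [inner_neg_right] at hyν
    rw [dirWidth] at h2
    have h4 := mul_le_mul_of_nonneg_left h1 (Nat.cast_nonneg (α := ℝ) d)
    rw [← le_sub_iff_add_le', div_le_iff₀ hd1]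
    linarith
  have hw : 0 ≤ minWidth K / (d + 1) := div_nonneg (minWidth_nonneg hK) hd1.le
  refine ⟨x, mem_of_forall_inner_le_supportFun hK hv hn fun ν hν => by linarith [hball ν hν],
    fun y hy => mem_of_forall_inner_le_supportFun hK hv hn fun ν hν => ?_⟩
  have h1 := real_inner_le_norm (y - x) ν
  rw [inner_sub_left, hν, mul_one] at h1
  rw [mem_ball, dist_eq_norm] at hy
  linarith [hball ν hν]

/-- The homothety with centre `y` and ratio `s` maps the ball about `x` to one of radius `s * ρ`,
still in `K` by convexity. -/
theorem smul_add_smul_mem_innerParallel [NeZero d] (hK : IsCompact K) (hv : Convex ℝ K)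
    {y : EuclideanSpace ℝ (Fin d)} {ρ s : ℝ} (hx : x ∈ K) (hball : ball x ρ ⊆ K) (hy : y ∈ K)
    (hs0 : 0 < s) (hs1 : s ≤ 1) : (1 - s) • y + s • x ∈ innerParallel K (s * ρ) := by
  refine mem_innerParallel_of_ball_subset hK (hv hy hx (by linarith) hs0.le (by ring)) fun z hz => ?_
  set p := (1 - s) • y + s • x with hp
  have hmem : x + s⁻¹ • (z - p) ∈ K := by
    apply hball
    rw [mem_ball, dist_eq_norm] at hz ⊢
    rw [add_sub_cancel_left, norm_smul, norm_inv, Real.norm_of_nonneg hs0.le,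
      inv_mul_lt_iff₀ hs0]
    exact hz
  have hz' : z = (1 - s) • y + s • (x + s⁻¹ • (z - p)) := by
    rw [smul_add, smul_inv_smul₀ hs0.ne', hp]
    abel
  rw [hz']
  exact hv hy hmem (by linarith) hs0.le (by ring)

/-- The minimal width of the inner parallel sets decreases at rate at most `d + 1`. -/
theorem minWidth_sub_le_minWidth_innerParallel [NeZero d] (hK : IsCompact K) (hv : Convex ℝ K)
    (hn : K.Nonempty) (ht : 0 ≤ t) :
    minWidth K - (d + 1) * t ≤ minWidth (innerParallel K t) := by
  have hd1 : (0 : ℝ) < d + 1 := by positivity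
  -- If the left side is negative the bound is trivial, even for an empty inner parallel set, whose
  -- `minWidth` is still nonnegative.
  rcases lt_or_ge (minWidth K) ((d + 1) * t) with hlt | hle
  · linarith [minWidth_nonneg (isCompact_innerParallel hK t)]
  rcases ht.eq_or_lt with rfl | htpos
  · have : innerParallel K 0 = K := by ext x; simp [innerParallel, infDist_nonneg]
    simp [this]
  have hw : 0 < minWidth K := lt_of_lt_of_le (by positivity) hle
  obtain ⟨x, hx, hball⟩ := exists_ball_subset_of_minWidth hK hv hn
  set s := (d + 1) * t / minWidth K with hs
  have hs0 : 0 < s := by positivity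
  have hs1 : s ≤ 1 := (div_le_one hw).2 hle
  have hst : s * (minWidth K / (d + 1)) = t := by rw [hs]; field_simp
  have hsw : s * minWidth K = (d + 1) * t := by rw [hs]; field_simp
  refine le_minWidth fun ν hν => ?_
  have hsupp : ∀ μ, (1 - s) * supportFun K μ + s * inner ℝ x μ ≤
      supportFun (innerParallel K t) μ := by
    intro μ
    obtain ⟨y, hy, hyμ⟩ := exists_supportFun_eq_inner hK hn μ
    have h1 := smul_add_smul_mem_innerParallel hK hv hx hball hy hs0 hs1
    rw [hst] at h1
    have h2 := inner_le_supportFun (ν := μ) (isCompact_innerParallel hK t) h1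
    rwa [inner_add_left, real_inner_smul_left, real_inner_smul_left, ← hyμ] at h2
  have h1 := hsupp ν
  have h2 := hsupp (-ν)
  rw [inner_neg_right] at h2
  have h3 := mul_le_mul_of_nonneg_left (minWidth_le_dirWidth hK hν) (sub_nonneg.2 hs1)
  rw [dirWidth] at h3 ⊢
  linarith

theorem innerParallel_nonempty (hK : IsCompact K) (hn : K.Nonempty) (ht : t ≤ inradius K) :
    (innerParallel K t).Nonempty := by
  obtain ⟨x, hx, hxr⟩ := hK.exists_sSup_image_eq hn (f := fun x => infDist x (frontier K))
    (continuous_infDist_pt _).continuousOn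
  exact ⟨x, hx, ht.trans hxr.le⟩

end Support

/-! ### Equality for equilateral triangles -/

section Equilateral

/-- The centre is the centroid and `R = a / √3` for side `a`. Eliminating `q 2` turns the side
lengths into a linear system for the Gram entries. -/
theorem Affine.Simplex.Equilateral.exists_center {V : Type*} [NormedAddCommGroup V]
    [InnerProductSpace ℝ V] {T : Affine.Triangle ℝ V} (hT : T.Equilateral) :
    ∃ (c : V) (R : ℝ) (q : Fin 3 → V), 0 < R ∧ (∀ i, T.points i = c + q i) ∧
      q 0 + q 1 + q 2 = 0 ∧ (∀ i, ‖q i‖ = R) ∧ ∀ i j, i ≠ j → inner ℝ (q i) (q j) = -(R ^ 2 / 2) := by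
  obtain ⟨a, ha⟩ := hT
  have hne : T.points 0 ≠ T.points 1 := T.independent.injective.ne (by decide)
  have ha0 : 0 < a := by rw [← ha 0 1 (by decide)]; exact dist_pos.2 hne
  set c : V := (3 : ℝ)⁻¹ • (T.points 0 + T.points 1 + T.points 2) with hc
  set q : Fin 3 → V := fun i => T.points i - c with hq
  have hsum : q 0 + q 1 + q 2 = 0 := by
    simp only [hq, hc]; module
  have h2 : q 2 = -q 0 - q 1 := by rw [← sub_eq_zero, ← hsum]; abel
  have hd : ∀ i j, i ≠ j → inner ℝ (q i - q j) (q i - q j) = a ^ 2 := by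
    intro i j hij
    rw [real_inner_self_eq_norm_sq, ← ha i j hij, dist_eq_norm]
    simp [hq]
  have e01 := hd 0 1 (by decide)
  have e02 := hd 0 2 (by decide)
  have e12 := hd 1 2 (by decide)
  rw [h2] at e02 e12
  simp only [inner_sub_left, inner_sub_right, inner_neg_left, inner_neg_right,
    real_inner_comm (q 0) (q 1)] at e01 e02 e12
  have hR : (a / √3) ^ 2 = a ^ 2 / 3 := by rw [div_pow, Real.sq_sqrt (by norm_num)]
  have hR0 : 0 < a / √3 := by positivity
  have i00 : inner ℝ (q 0) (q 0) = a ^ 2 / 3 := by linarith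
  have i11 : inner ℝ (q 1) (q 1) = a ^ 2 / 3 := by linarith
  have i01 : inner ℝ (q 0) (q 1) = -(a ^ 2 / 3 / 2) := by linarith
  have i22 : inner ℝ (q 2) (q 2) = a ^ 2 / 3 := by
    rw [h2]
    simp only [inner_sub_left, inner_sub_right, inner_neg_left, inner_neg_right,
      real_inner_comm (q 0) (q 1)]
    linarith
  have hself : ∀ i, inner ℝ (q i) (q i) = a ^ 2 / 3 := by
    intro i
    fin_cases i
    exacts [i00, i11, i22]
  refine ⟨c, a / √3, q, hR0, fun i => by simp [hq], hsum, fun i => ?_, fun i j hij => ?_⟩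
  · rw [← sq_eq_sq₀ (norm_nonneg _) hR0.le, hR, ← real_inner_self_eq_norm_sq, hself]
  · have := hd i j hij
    rw [real_inner_sub_sub_self, hself, hself] at this
    rw [hR]
    linarith

/-- The Gram determinant of three vectors in the plane vanishes. -/
theorem gram_det_eq_zero (a b m : EuclideanSpace ℝ (Fin 2)) :
    inner ℝ a a * inner ℝ b b * inner ℝ m m + 2 * (inner ℝ a b * inner ℝ a m * inner ℝ b m)
      - inner ℝ a a * inner ℝ b m ^ 2 - inner ℝ b b * inner ℝ a m ^ 2
      - inner ℝ m m * inner ℝ a b ^ 2 = 0 := by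
  simp only [PiLp.inner_apply, Fin.sum_univ_two, RCLike.inner_apply, conj_trivial]
  ring

/-- Here `u`, `v`, `-u - v` are the heights of the vertices over the centre. Of their three
differences, the largest in size is `a + b` with `a, b ≥ 0` the sizes of the others, and `(a + b) ^
2 ≥ a ^ 2 + a * b + b ^ 2 = 9 / 4 * R ^ 2`. -/
theorem le_of_sq_add_mul_add_sq {u v R D : ℝ} (hD : 0 ≤ D)
    (h : u ^ 2 + u * v + v ^ 2 = 3 / 4 * R ^ 2) (h1 : |u - v| ≤ D) (h2 : |u + 2 * v| ≤ D)
    (h3 : |2 * u + v| ≤ D) : 3 / 2 * R ≤ D := by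
  refine le_of_sq_le_sq ?_ hD
  have s1 := sq_le_sq' (abs_le.1 h1).1 (abs_le.1 h1).2
  have s2 := sq_le_sq' (abs_le.1 h2).1 (abs_le.1 h2).2
  have s3 := sq_le_sq' (abs_le.1 h3).1 (abs_le.1 h3).2
  rcases le_total 0 (u - v) with hp | hp <;> rcases le_total 0 (u + 2 * v) with hq | hq <;>
    rcases le_total 0 (2 * u + v) with hr | hr <;> nlinarith

theorem minWidth_convexHull_innerParallel_of_equilateral
    {T : Affine.Triangle ℝ (EuclideanSpace ℝ (Fin 2))} (hT : T.Equilateral) {t : ℝ}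
    (ht : t ≤ inradius (convexHull ℝ (Set.range T.points))) :
    minWidth (innerParallel (convexHull ℝ (Set.range T.points)) t) ≤
      minWidth (convexHull ℝ (Set.range T.points)) - 3 * t := by
  set K := convexHull ℝ (Set.range T.points) with hKdef
  have hK : IsCompact K := (Set.finite_range _).isCompact_convexHull ℝ
  have hmem : ∀ i, T.points i ∈ K := fun i => subset_convexHull ℝ _ (Set.mem_range_self i)
  obtain ⟨c, R, q, hR, hp, hsum, hnorm, hinner⟩ := hT.exists_center
  have hlower : 3 / 2 * R ≤ minWidth K := by
    refine le_minWidth fun μ hμ => ?_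
    have hgram := gram_det_eq_zero (q 0) (q 1) μ
    simp only [real_inner_self_eq_norm_sq, hnorm, hμ, hinner 0 1 (by decide)] at hgram
    have hd : ∀ i j, inner ℝ (q i) μ - inner ℝ (q j) μ ≤ dirWidth K μ := fun i j => by
      simpa [hp, inner_sub_left] using inner_sub_le_dirWidth (ν := μ) hK (hmem i) (hmem j)
    have h2 : inner ℝ (q 2) μ = -inner ℝ (q 0) μ - inner ℝ (q 1) μ := by
      have := congrArg (fun a => inner ℝ a μ) hsum
      simp only [inner_add_left, inner_zero_left] at this
      linarith
    refine le_of_sq_add_mul_add_sq (u := inner ℝ (q 0) μ) (v := inner ℝ (q 1) μ)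
      (dirWidth_nonneg hK) ?_ ?_ ?_ ?_
    · apply mul_left_cancel₀ (pow_ne_zero 2 hR.ne')
      linarith
    · exact abs_le.2 ⟨by linarith [hd 1 0], hd 0 1⟩
    · exact abs_le.2 ⟨by linarith [hd 2 1], by linarith [hd 1 2]⟩
    · exact abs_le.2 ⟨by linarith [hd 2 0], by linarith [hd 0 2]⟩
  -- The outward unit normal of the side opposite vertex `i`, which lies at distance `R / 2` from
  -- `c`.
  set ν : Fin 3 → EuclideanSpace ℝ (Fin 2) := fun i => -(R⁻¹ • q i) with hν
  have hν1 : ∀ i, ‖ν i‖ = 1 := fun i => by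
    rw [hν, norm_neg, norm_smul, norm_inv, Real.norm_of_nonneg hR.le, hnorm,
      inv_mul_cancel₀ hR.ne']
  have hνsum : ν 1 + ν 2 = -ν 0 := by
    have : q 0 = -(q 1 + q 2) := by rw [← sub_eq_zero, ← hsum]; abel
    simp only [hν, this]
    module
  have hhalf : ∀ i, ∀ y ∈ K, inner ℝ y (ν i) ≤ inner ℝ c (ν i) + R / 2 := by
    intro i
    have hconv : Convex ℝ {y : EuclideanSpace ℝ (Fin 2) |
        inner ℝ y (ν i) ≤ inner ℝ c (ν i) + R / 2} :=
      convex_halfSpace_le ⟨fun _ _ => inner_add_left _ _ _,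
        fun _ _ => real_inner_smul_left _ _ _⟩ _
    refine fun y hy => convexHull_min ?_ hconv hy
    rintro _ ⟨j, rfl⟩
    rw [Set.mem_ofPred_eq, hp, inner_add_left, add_le_add_iff_left]
    simp only [hν, inner_neg_right, real_inner_smul_right]
    by_cases hji : j = i
    · rw [hji, real_inner_self_eq_norm_sq, hnorm]
      have : 0 ≤ R⁻¹ * R ^ 2 := by positivity
      linarith
    · rw [hinner j i hji]
      apply le_of_eq
      field_simp
  have hn : (innerParallel K t).Nonempty := innerParallel_nonempty hK ⟨_, hmem 0⟩ ht
  have hin : ∀ i, ∀ x ∈ innerParallel K t, inner ℝ x (ν i) ≤ inner ℝ c (ν i) + R / 2 - t :=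
    fun i x hx => inner_le_sub_of_mem_innerParallel hK (hν1 i) (hhalf i) hx
  have h1 := supportFun_le hn (hin 0)
  -- As `-ν 0 = ν 1 + ν 2`, the other two sides bound this direction.
  have h2 : supportFun (innerParallel K t) (-ν 0) ≤ -inner ℝ c (ν 0) + 2 * (R / 2 - t) := by
    refine supportFun_le hn fun x hx => ?_
    have hc : inner ℝ c (ν 1) + inner ℝ c (ν 2) = -inner ℝ c (ν 0) := by
      rw [← inner_add_right, hνsum, inner_neg_right]
    rw [← hνsum, inner_add_right]
    linarith [hin 1 x hx, hin 2 x hx]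
  have h3 := minWidth_le_dirWidth (isCompact_innerParallel hK t) (hν1 0)
  rw [dirWidth] at h3
  linarith

end Equilateral

theorem lemma4p4 :
    (∀ K : Set (EuclideanSpace ℝ (Fin 2)), IsConvexBody K →
      ∀ t ∈ Set.Icc (0 : ℝ) (inradius K),
        minWidth K - 3 * t ≤ minWidth (innerParallel K t)) ∧
    (∀ T : Affine.Triangle ℝ (EuclideanSpace ℝ (Fin 2)), T.Equilateral →
      ∀ t ∈ Set.Icc (0 : ℝ) (inradius (convexHull ℝ (Set.range T.points))),
        minWidth (innerParallel (convexHull ℝ (Set.range T.points)) t) =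
          minWidth (convexHull ℝ (Set.range T.points)) - 3 * t) := by
  have h3 : ((2 : ℕ) : ℝ) + 1 = 3 := by norm_num
  refine ⟨fun K hK t ht => ?_, fun T hT t ht => ?_⟩
  · have := minWidth_sub_le_minWidth_innerParallel hK.isCompact hK.convex
      (hK.interior_nonempty.mono interior_subset) ht.1
    rwa [h3] at this
  · refine le_antisymm (minWidth_convexHull_innerParallel_of_equilateral hT ht.2) ?_
    have := minWidth_sub_le_minWidth_innerParallel ((Set.finite_range T.points).isCompact_convexHull ℝ)
      (convex_convexHull ℝ _) ((Set.range_nonempty T.points).convexHull) ht.1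
    rwa [h3] at this
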